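/- Let $n\ge 0$ and let $X=\{0,1\}^n$. Identify a Boolean function $f:X\to\{0,1\}$ with a vertex of the binary $2^n$-cube $\{0,1\}^X$, whose coordinates are the points of $X$; a point is also thought of as the monomial $\prod_{i\in I}x_i$, where $I$ is the set of positions of its ones, and its degree is $|I|$. For a concept class $C\subseteq\{0,1\}^X$, the VC dimension of $C$ is the largest size of a set of coordinates on which $C$ realises all $0/1$ patterns, and $C$ of VC dimension $d$ is called maximum if $|C|=\sum_{i=0}^{d}\binom{2^n}{i}$ (equality in Sauer's lemma). Let $\mathcal F\subseteq\{0,1\}^X$ be the class of symmetric Boolean functions, i.e. those $f$ whose value does not change when the $n$ variables are permuted. Then $\mathcal F$ has VC dimension $n+1$, and there exists a maximum class $\mathcal M\subseteq\{0,1\}^X$ of VC dimension $n+1$ with $\mathcal F\subseteq\mathcal M$. Moreover, such a class is given explicitly as follows. Fix any total ordering of the $2^n$ monomials in which monomials of smaller degree come before monomials of larger degree. For every set $A\subseteq X$ of $n+2$ coordinates there are two distinct elements of $A$ of the same degree; let $m_A$ be the first element, in the ordering, among those $m\in A$ for which $A$ contains another element of the same degree as $m$. Let $Q_A$ be the subcube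 of all $c\in\{0,1\}^X$ with $c(m_A)=1$ and $c(x)=0$ for every $x\in A\setminus\{m_A\}$. Then, for every such ordering, the complement $$\mathcal M=\{0,1\}^X\setminus\bigcup_{A\subseteq X,\ |A|=n+2}Q_A$$ is a maximum class of VC dimension $n+1$ and contains $\mathcal F$. -/

import Mathlib

namespace BooleanClasses

/-- A concept on the coordinate set `α`: a vertex of the binary cube `{0,1}^α`. -/
abbrev Concept (α : Type*) := α → Bool

/-- The support of a concept. -/
def support {α : Type*} [Fintype α] (c : Concept α) : Finset α :=
  Finset.univ.filter (fun a => c a = true)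

/-- The VC dimension of a concept class: the VC dimension of the family of supports of its
concepts, i.e. the largest size of a set `I` of coordinates such that every 0/1 pattern on `I`
is the restriction to `I` of some concept of the class. -/
def vcDim {α : Type*} [Fintype α] [DecidableEq α] (C : Finset (Concept α)) : ℕ :=
  (C.image support).vcDim

/-- A concept class is maximum if it meets Sauer's bound with equality. -/
def IsMaximum {α : Type*} [Fintype α] [DecidableEq α] (C : Finset (Concept α)) : Prop :=
  C.card = ∑ i ∈ Finset.range (vcDim C + 1), (Fintype.card α).choose i

/-- The points of the binary `n`-cube. They are the `2 ^ n` coordinates of the cube in which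
Boolean functions of `n` variables live. The monomial `∏ i ∈ I, x_i` stands for the point whose
entries equal to one are exactly those at the positions in `I`. -/
abbrev Point (n : ℕ) := Fin n → Bool

/-- The degree of a monomial: the number of ones of the corresponding point. The class `S_i`
consists of the points of degree `i`. -/
def degree {n : ℕ} (x : Point n) : ℕ := (support x).card

/-- A Boolean function is symmetric if permuting the variables does not change its values. -/
def IsSymmetric {n : ℕ} (f : Concept (Point n)) : Prop :=
  ∀ (σ : Equiv.Perm (Fin n)) (x : Point n), f (x ∘ σ) = f x

open scoped Classical in
/-- The class of symmetric Boolean functions of `n` variables. -/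
noncomputable def symmetricClass (n : ℕ) : Finset (Concept (Point n)) :=
  Finset.univ.filter IsSymmetric

/-- An ordering of the monomials (`pos x` is the place of `x` in the list) in which monomials
of smaller degree come before those of larger degree. -/
def IsDegreeOrdering {n : ℕ} (pos : Point n ≃ Fin (2 ^ n)) : Prop :=
  ∀ x y : Point n, degree x < degree y → pos x < pos y

/-- `x` belongs to `A`, and `A` has a second element of the same degree as `x`. -/
def IsRepeated {n : ℕ} (A : Finset (Point n)) (x : Point n) : Prop :=
  x ∈ A ∧ ∃ y ∈ A, y ≠ x ∧ degree y = degree x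

/-- `m` is the special coordinate of `A`: the first one in the ordering among the elements of `A`
whose degree is repeated in `A`. -/
def IsSpecial {n : ℕ} (pos : Point n ≃ Fin (2 ^ n)) (A : Finset (Point n)) (m : Point n) : Prop :=
  IsRepeated A m ∧ ∀ x, IsRepeated A x → pos m ≤ pos x

/-- The subcube with anchor coordinates `A`, where the anchor is `1` at the special coordinate
of `A` and `0` at all other coordinates of `A`; the coordinates outside `A` are free. -/
def anchoredCube {n : ℕ} (pos : Point n ≃ Fin (2 ^ n)) (A : Finset (Point n)) :
    Set (Concept (Point n)) :=
  {c | ∀ x ∈ A, (c x = true ↔ IsSpecial pos A x)}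

open scoped Classical in
/-- The class whose complement is the union of the anchored cubes over all sets of `n + 2`
anchor coordinates. -/
noncomputable def anchorClass {n : ℕ} (pos : Point n ≃ Fin (2 ^ n)) :
    Finset (Concept (Point n)) :=
  Finset.univ.filter (fun c => ¬ ∃ A : Finset (Point n), A.card = n + 2 ∧ c ∈ anchoredCube pos A)

end BooleanClasses

/-! Each `A` of size `n + 2` misses the pattern of its anchor, so the class has VC dimension at most
`n + 1`. A symmetric function cannot be 1 at the special coordinate and 0 at another point of the
same degree, so it avoids every anchored cube. By Sauer's lemma it remains to find as many members
as there are sets `T` of at most `n + 1` points.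

Send `T` to the concept vanishing exactly on its shifted set. `T` can be recovered from this set
(`subset_of_isShifted_iff`). If the concept lay in the cube of `A`, the shifted set would meet `A`
in everything but the special coordinate; comparing layers degree by degree
(`card_le_of_isShifted_iff_ne`) then gives `A.card ≤ T.card`, which is impossible. -/

namespace BooleanClasses

/-! ### Shifted sets over a graded ordered set -/

section Shift

variable {X : Type*} (deg pos : X → ℕ) (T : Finset X)

/-- The elements of `T` of degree `i`. -/
def layer (T : Finset X) (i : ℕ) : Finset X := T.filter (fun x => deg x = i)

/-- `i` is the first degree that occurs more than once in `T`. -/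
def IsFirstHeavy (i : ℕ) : Prop :=
  1 < (layer deg T i).card ∧ ∀ k < i, (layer deg T k).card ≤ 1

/-- All degrees up to and including `i` occur at most once in `T`. -/
def IsLightUpTo (i : ℕ) : Prop := ∀ k ≤ i, (layer deg T k).card ≤ 1

/-- Layers of `T` below the first heavy one become initial segments; in the first heavy layer
the first element is exchanged for the points preceding it; the later layers are unchanged. -/
def IsShifted (x : X) : Prop :=
  (IsLightUpTo deg T (deg x) ∧ ∃ t ∈ T, deg t = deg x ∧ pos x ≤ pos t) ∨
  (IsFirstHeavy deg T (deg x) ∧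
    ((x ∈ T ∧ ∃ t ∈ T, deg t = deg x ∧ pos t < pos x) ∨
      ∀ t ∈ T, deg t = deg x → pos x < pos t)) ∨
  (x ∈ T ∧ ∃ i < deg x, IsFirstHeavy deg T i)

variable {deg pos T}

lemma mem_layer {i : ℕ} {x : X} : x ∈ layer deg T i ↔ x ∈ T ∧ deg x = i := by
  simp [layer]

lemma isLightUpTo_or_exists_isFirstHeavy (i : ℕ) :
    IsLightUpTo deg T i ∨ ∃ j ≤ i, IsFirstHeavy deg T j := by
  classical
  by_cases h : ∃ k, k ≤ i ∧ 1 < (layer deg T k).card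
  · refine Or.inr ⟨Nat.find h, (Nat.find_spec h).1, (Nat.find_spec h).2, fun k hk => ?_⟩
    have h1 := Nat.find_min h hk
    have h2 := (Nat.find_spec h).1
    by_contra hc
    exact h1 ⟨by omega, by omega⟩
  · left
    intro k hk
    by_contra hc
    exact h ⟨k, hk, by omega⟩

lemma IsFirstHeavy.eq {i j : ℕ} (hi : IsFirstHeavy deg T i) (hj : IsFirstHeavy deg T j) :
    i = j := by
  rcases lt_trichotomy i j with h | h | h
  · have := hj.2 i h
    have := hi.1
    omega
  · exact h
  · have := hi.2 j h
    have := hj.1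
    omega

lemma IsFirstHeavy.not_isLightUpTo {i j : ℕ} (hi : IsFirstHeavy deg T i) (hij : i ≤ j) :
    ¬ IsLightUpTo deg T j := fun h => by
  have := h i hij
  have := hi.1
  omega

lemma IsFirstHeavy.isLightUpTo {i j : ℕ} (hj : IsFirstHeavy deg T j) (hij : i < j) :
    IsLightUpTo deg T i := fun k hk => hj.2 k (by omega)

lemma isShifted_of_isLightUpTo {x : X} (h : IsLightUpTo deg T (deg x)) :
    IsShifted deg pos T x ↔ ∃ t ∈ T, deg t = deg x ∧ pos x ≤ pos t := by
  constructor
  · rintro (h' | h' | ⟨-, i, hi, h'⟩)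
    · exact h'.2
    · exact absurd h (h'.1.not_isLightUpTo le_rfl)
    · exact absurd h (h'.not_isLightUpTo hi.le)
  · exact fun h' => Or.inl ⟨h, h'⟩

lemma isShifted_of_isFirstHeavy {x : X} (h : IsFirstHeavy deg T (deg x)) :
    IsShifted deg pos T x ↔ (x ∈ T ∧ ∃ t ∈ T, deg t = deg x ∧ pos t < pos x) ∨
      ∀ t ∈ T, deg t = deg x → pos x < pos t := by
  constructor
  · rintro (h' | h' | ⟨-, i, hi, h'⟩)
    · exact absurd h'.1 (h.not_isLightUpTo le_rfl)
    · exact h'.2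
    · exact absurd (h'.eq h) hi.ne
  · exact fun h' => Or.inr (Or.inl ⟨h, h'⟩)

lemma isShifted_of_isFirstHeavy_lt {x : X} {i : ℕ} (h : IsFirstHeavy deg T i) (hi : i < deg x) :
    IsShifted deg pos T x ↔ x ∈ T := by
  constructor
  · rintro (h' | h' | h')
    · exact absurd h'.1 (h.not_isLightUpTo hi.le)
    · exact absurd (h.eq h'.1) hi.ne
    · exact h'.1
  · exact fun h' => Or.inr (Or.inr ⟨h', i, hi, h⟩)

lemma exists_first_of_layer_nonempty {i : ℕ} (h : (layer deg T i).Nonempty) :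
    ∃ t ∈ T, deg t = i ∧ ∀ s ∈ T, deg s = i → pos t ≤ pos s := by
  obtain ⟨t, ht, hmin⟩ := Finset.exists_min_image _ pos h
  rw [mem_layer] at ht
  exact ⟨t, ht.1, ht.2, fun s hs hsi => hmin s (mem_layer.2 ⟨hs, hsi⟩)⟩

/-- The first element of the first heavy layer is not shifted, but a later one is. -/
lemma IsFirstHeavy.exists_descent (hpos : Function.Injective pos) {i : ℕ}
    (h : IsFirstHeavy deg T i) :
    ∃ t ∈ T, deg t = i ∧ (∀ s ∈ T, deg s = i → pos t ≤ pos s) ∧ ¬ IsShifted deg pos T t ∧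
      ∃ s ∈ T, deg s = i ∧ pos t < pos s ∧ IsShifted deg pos T s := by
  obtain ⟨t, htT, hti, hmin⟩ := exists_first_of_layer_nonempty (pos := pos)
    (Finset.card_pos.1 (zero_lt_one.trans h.1))
  obtain ⟨s, hs, hst⟩ := Finset.exists_mem_ne h.1 t
  rw [mem_layer] at hs
  have hlt : pos t < pos s := lt_of_le_of_ne (hmin s hs.1 hs.2) fun e => hst (hpos e).symm
  refine ⟨t, htT, hti, hmin, ?_, s, hs.1, hs.2, hlt, ?_⟩
  · rw [isShifted_of_isFirstHeavy (hti ▸ h)]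
    rintro (⟨-, u, hu, hut, hlt⟩ | h')
    · exact absurd (hmin u hu (hut.trans hti)) (by omega)
    · exact lt_irrefl _ (h' t htT rfl)
  · rw [isShifted_of_isFirstHeavy (by rw [hs.2]; exact h)]
    exact Or.inl ⟨hs.1, t, htT, hti.trans hs.2.symm, hlt⟩

/-- A light layer shifts to an initial segment, which has no unshifted point before a shifted one; a
first heavy layer always has such a pair. -/
lemma IsFirstHeavy.of_isShifted_iff (hpos : Function.Injective pos) {T' : Finset X}
    (hT : ∀ x, IsShifted deg pos T x ↔ IsShifted deg pos T' x) {i : ℕ}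
    (h : IsFirstHeavy deg T i) : ∃ j ≤ i, IsFirstHeavy deg T' j := by
  refine (isLightUpTo_or_exists_isFirstHeavy i).resolve_left fun hl => ?_
  obtain ⟨t, htT, hti, -, hnt, s, hsT, hsi, hts, hs⟩ := h.exists_descent hpos
  rw [hT] at hnt hs
  rw [isShifted_of_isLightUpTo (by rwa [hsi])] at hs
  rw [isShifted_of_isLightUpTo (by rwa [hti])] at hnt
  obtain ⟨u, hu, hus, hle⟩ := hs
  exact hnt ⟨u, hu, by omega, by omega⟩

/-- The first heavy degree is visible in the shifted set. A light layer is recovered as the last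
point of its segment, the heavy one from its first unshifted point. -/
lemma subset_of_isShifted_iff (hpos : Function.Injective pos) {T' : Finset X}
    (hT : ∀ x, IsShifted deg pos T x ↔ IsShifted deg pos T' x) : T ⊆ T' := by
  have key : ∀ {i}, IsFirstHeavy deg T i → IsFirstHeavy deg T' i := by
    intro i hi
    obtain ⟨j, hj, hj'⟩ := hi.of_isShifted_iff hpos hT
    obtain ⟨k, hk, hk'⟩ := hj'.of_isShifted_iff hpos fun x => (hT x).symm
    have := hk'.eq hi
    have : j = i := by omega
    exact this ▸ hj'
  intro x hx
  rcases isLightUpTo_or_exists_isFirstHeavy (deg := deg) (T := T) (deg x) with hl | ⟨j, hj, hj'⟩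
  · have hl' : IsLightUpTo deg T' (deg x) := by
      refine (isLightUpTo_or_exists_isFirstHeavy (deg x)).resolve_right ?_
      rintro ⟨j, hj, hj'⟩
      obtain ⟨k, hk, hk'⟩ := hj'.of_isShifted_iff hpos fun x => (hT x).symm
      exact hk'.not_isLightUpTo (hk.trans hj) hl
    have hxs := (isShifted_of_isLightUpTo (pos := pos) hl).2 ⟨x, hx, rfl, le_rfl⟩
    rw [hT, isShifted_of_isLightUpTo hl'] at hxs
    obtain ⟨t, ht, htx, hle⟩ := hxs
    have hts := (isShifted_of_isLightUpTo (deg := deg) (pos := pos) (x := t) (by rwa [htx])).2 ⟨t, ht, rfl, le_rfl⟩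
    rw [← hT, isShifted_of_isLightUpTo (by rwa [htx])] at hts
    obtain ⟨u, hu, hut, hle'⟩ := hts
    have hux : u = x := Finset.card_le_one.1 (hl _ le_rfl) u (mem_layer.2 ⟨hu, hut.trans htx⟩) x
      (mem_layer.2 ⟨hx, rfl⟩)
    subst hux
    rwa [hpos (le_antisymm hle hle')]
  · rcases hj.lt_or_eq with hlt | rfl
    · rwa [← isShifted_of_isFirstHeavy_lt (pos := pos) (key hj') hlt, ← hT,
        isShifted_of_isFirstHeavy_lt hj' hlt]
    · obtain ⟨t, ht, htx, hmin, hnt, -⟩ := hj'.exists_descent hpos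
      obtain ⟨t', ht', htx', hmin', hnt', -⟩ := (key hj').exists_descent hpos
      -- In the heavy layer, all points before the first element of the set are shifted and that
      -- element is not.
      have htt : t = t' := by
        apply hpos
        by_contra hne
        rcases lt_or_gt_of_ne hne with h | h
        · refine hnt ((hT t).2 ((isShifted_of_isFirstHeavy (by rw [htx]; exact key hj')).2
            (Or.inr fun s hs hst => ?_)))
          exact h.trans_le (hmin' s hs (hst.trans htx))
        · refine hnt' ((hT t').1 ((isShifted_of_isFirstHeavy (by rw [htx']; exact hj')).2
            (Or.inr fun s hs hst => ?_)))
          exact h.trans_le (hmin s hs (hst.trans htx'))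
      subst htt
      by_cases hxt : x = t
      · exact hxt ▸ ht'
      have hlt : pos t < pos x :=
        lt_of_le_of_ne (hmin x hx rfl) fun e => hxt (hpos e).symm
      have hxs := (isShifted_of_isFirstHeavy (pos := pos) hj').2
        (Or.inl ⟨hx, t, ht, htx, hlt⟩)
      rw [hT, isShifted_of_isFirstHeavy (key hj')] at hxs
      rcases hxs with h | h
      · exact h.1
      · exact absurd (h t ht' htx) (by omega)

/-- A set that meets the shifted set of `T` in all its elements except `m`, which is its first
element of repeated degree, is not larger than `T`. -/
lemma card_le_of_isShifted_iff_ne (hpos : Function.Injective pos)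
    (hdeg : ∀ x y, deg x < deg y → pos x < pos y) {A : Finset X} {m y : X} (hm : m ∈ A)
    (hy : y ∈ A) (hym : y ≠ m) (hdy : deg y = deg m)
    (hfirst : ∀ x ∈ A, ∀ z ∈ A, z ≠ x → deg z = deg x → pos m ≤ pos x)
    (hA : ∀ x ∈ A, IsShifted deg pos T x ↔ x ≠ m) : A.card ≤ T.card := by
  classical
  have hms : ¬ IsShifted deg pos T m := fun h => (hA m hm).1 h rfl
  have hys : IsShifted deg pos T y := (hA y hy).2 hym
  have hmy : pos m ≤ pos y := hfirst y hy m hm hym.symm hdy.symm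
  -- A repetition in a lower degree would precede `m`; only here is compatibility with degree used.
  have hone : ∀ i < deg m, (layer deg A i).card ≤ 1 := by
    intro i hi
    rw [Finset.card_le_one]
    intro a ha b hb
    rw [mem_layer] at ha hb
    by_contra hne
    have h1 := hfirst a ha.1 b hb.1 (Ne.symm hne) (hb.2.trans ha.2.symm)
    have h2 := hdeg a m (by omega)
    omega
  -- Otherwise the shifted points of degree `deg m` form an initial segment, containing `y` and
  -- hence `m`.
  obtain ⟨j, hjm, hj⟩ : ∃ j ≤ deg m, IsFirstHeavy deg T j := by
    refine (isLightUpTo_or_exists_isFirstHeavy (deg m)).resolve_left fun hl => hms ?_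
    rw [isShifted_of_isLightUpTo (by rwa [hdy])] at hys
    rw [isShifted_of_isLightUpTo hl]
    obtain ⟨t, ht, hty, hle⟩ := hys
    exact ⟨t, ht, hty.trans hdy, hmy.trans hle⟩
  obtain ⟨t, htT, htj, hmin, hnt, -⟩ := hj.exists_descent hpos
  -- The loss of `m` in degree `deg m` is paid for by the spare element of `T` in degree `j`; the
  -- two corrections cancel on summation.
  have hlayer : ∀ i, (layer deg A i).card + (if i = j then 1 else 0) ≤
      (layer deg T i).card + (if i = deg m then 1 else 0) := by
    intro i
    have habove : j < i → (layer deg A i).erase m ⊆ layer deg T i := by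
      intro hji x hx
      rw [Finset.mem_erase, mem_layer] at hx
      obtain ⟨hxm, hxA, rfl⟩ := hx
      rw [mem_layer]
      exact ⟨(isShifted_of_isFirstHeavy_lt hj hji).1 ((hA x hxA).2 hxm), rfl⟩
    rcases lt_trichotomy i j with hij | rfl | hij
    · rw [if_neg hij.ne, if_neg (by omega)]
      rcases (layer deg A i).eq_empty_or_nonempty with he | ⟨x, hx⟩
      · simp [he]
      have h1 := hone i (by omega)
      rw [mem_layer] at hx
      obtain ⟨hxA, rfl⟩ := hx
      have hxs := (hA x hxA).2 (by rintro rfl; omega)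
      rw [isShifted_of_isLightUpTo (hj.isLightUpTo hij)] at hxs
      obtain ⟨u, hu, hux, -⟩ := hxs
      have : 0 < (layer deg T (deg x)).card := Finset.card_pos.2 ⟨u, mem_layer.2 ⟨hu, hux⟩⟩
      omega
    · rcases hjm.lt_or_eq with hlt | rfl
      · rw [if_pos rfl, if_neg hlt.ne]
        have := hone i hlt
        have := hj.1
        omega
      · rw [if_pos rfl, add_le_add_iff_right]
        have hsub : insert t ((layer deg A (deg m)).erase m) ⊆ layer deg T (deg m) := by
          intro x hx
          rw [Finset.mem_insert, Finset.mem_erase, mem_layer] at hx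
          rw [mem_layer]
          rcases hx with rfl | ⟨hxm, hxA, hdx⟩
          · exact ⟨htT, htj⟩
          refine ⟨?_, hdx⟩
          have hxs := (hA x hxA).2 hxm
          rw [isShifted_of_isFirstHeavy (by rwa [hdx])] at hxs
          rcases hxs with h | h
          · exact h.1
          -- If `x` preceded all of this layer of `T`, so would `m`, and `m` would be shifted.
          refine absurd ((isShifted_of_isFirstHeavy hj).2 (Or.inr fun s hs hsm => ?_)) hms
          have h1 := hfirst x hxA m hm (Ne.symm hxm) hdx.symm
          exact h1.trans_lt (h s hs (hsm.trans hdx.symm))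
        have hnot : t ∉ (layer deg A (deg m)).erase m := by
          intro h
          rw [Finset.mem_erase, mem_layer] at h
          exact hnt ((hA t h.2.1).2 h.1)
        have := Finset.card_le_card hsub
        rw [Finset.card_insert_of_notMem hnot,
          Finset.card_erase_add_one (mem_layer.2 ⟨hm, rfl⟩)] at this
        exact this
    · rw [if_neg hij.ne']
      have h1 := Finset.card_le_card (habove hij)
      split_ifs with him
      · have := Finset.pred_card_le_card_erase (s := layer deg A i) (a := m)
        omega
      · rw [Finset.erase_eq_of_notMem (fun h => him (mem_layer.1 h).2.symm)] at h1
        exact h1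
  have hsum : ∀ {K : ℕ} (B : Finset X), (∀ x ∈ B, deg x < K) →
      B.card = ∑ i ∈ Finset.range K, (layer deg B i).card := fun B hB =>
    Finset.card_eq_sum_card_fiberwise fun x hx => Finset.mem_coe.2 (Finset.mem_range.2 (hB x hx))
  set K := (A ∪ T).sup deg + 1 with hK
  have hlt : ∀ x ∈ A ∪ T, deg x < K := fun x hx => Nat.lt_succ_of_le (Finset.le_sup hx)
  have h := Finset.sum_le_sum fun i (_ : i ∈ Finset.range K) => hlayer i
  rw [Finset.sum_add_distrib, Finset.sum_add_distrib,
    ← hsum A fun x hx => hlt x (Finset.mem_union_left _ hx),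
    ← hsum T fun x hx => hlt x (Finset.mem_union_right _ hx),
    Finset.sum_ite_eq', Finset.sum_ite_eq',
    if_pos (Finset.mem_range.2 (hlt m (Finset.mem_union_left _ hm))),
    if_pos (Finset.mem_range.2 (htj ▸ hlt t (Finset.mem_union_right _ htT)))] at h
  omega

end Shift

lemma card_filter_card_lt (X : Type*) [Fintype X] [DecidableEq X] (k : ℕ) :
    (Finset.univ.filter fun T : Finset X => T.card < k).card =
      ∑ i ∈ Finset.range k, (Fintype.card X).choose i := by
  rw [Finset.card_eq_sum_card_fiberwise (f := Finset.card) (t := Finset.range k)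
    (fun T hT => by simpa using hT)]
  refine Finset.sum_congr rfl fun i hi => ?_
  rw [← Finset.card_univ, ← Finset.card_powersetCard]
  congr 1
  ext T
  have := Finset.mem_range.1 hi
  simp only [Finset.mem_filter, Finset.mem_univ, true_and, Finset.mem_powersetCard,
    Finset.subset_univ]
  omega

lemma mem_support {α : Type*} [Fintype α] {c : Concept α} {a : α} :
    a ∈ support c ↔ c a = true := by
  simp [support]

lemma support_injective (α : Type*) [Fintype α] :
    Function.Injective (support : Concept α → Finset α) := by
  intro c c' h
  funext a
  rw [Bool.eq_iff_iff, ← mem_support, ← mem_support, h]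

/-! ### VC dimension and Sauer's bound -/

section VC

variable {α : Type*} [Fintype α] [DecidableEq α] {C D : Finset (Concept α)}

lemma vcDim_mono (h : C ⊆ D) : vcDim C ≤ vcDim D :=
  Finset.vcDim_mono (Finset.image_subset_image h)

lemma card_le_sum_choose (C : Finset (Concept α)) :
    C.card ≤ ∑ i ∈ Finset.range (vcDim C + 1), (Fintype.card α).choose i := by
  have h := (Finset.card_le_card_shatterer (C.image support)).trans
    Finset.card_shatterer_le_sum_vcDim
  rw [Finset.card_image_of_injective _ (support_injective α)] at h
  rwa [Nat.range_succ_eq_Iic]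

/-- A set of coordinates is shattered iff all its patterns are realised. -/
lemma shatters_iff {A : Finset α} :
    (C.image support).Shatters A ↔ ∀ p : Concept α, ∃ c ∈ C, ∀ x ∈ A, c x = p x := by
  constructor
  · intro h p
    obtain ⟨u, hu, hu'⟩ := h (Finset.filter_subset (fun x => p x = true) A)
    obtain ⟨c, hc, rfl⟩ := Finset.mem_image.1 hu
    refine ⟨c, hc, fun x hx => ?_⟩
    have := Finset.ext_iff.1 hu' x
    simp only [Finset.mem_inter, hx, true_and, mem_support, Finset.mem_filter] at this
    rwa [Bool.eq_iff_iff]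
  · intro h B hB
    obtain ⟨c, hc, hcB⟩ := h fun x => decide (x ∈ B)
    refine ⟨support c, Finset.mem_image_of_mem _ hc, ?_⟩
    ext x
    rw [Finset.mem_inter, mem_support]
    constructor
    · rintro ⟨hx, hcx⟩
      simpa [hcB x hx] using hcx
    · intro hx
      exact ⟨hB hx, by simpa [hcB x (hB hx)] using hx⟩

lemma le_vcDim_of_realises {A : Finset α} (h : ∀ p : Concept α, ∃ c ∈ C, ∀ x ∈ A, c x = p x) :
    A.card ≤ vcDim C :=
  (shatters_iff.2 h).card_le_vcDim

lemma vcDim_le_of_forall_exists_missing {d : ℕ}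
    (h : ∀ A : Finset α, A.card = d + 1 → ∃ p : Concept α, ∀ c ∈ C, ∃ x ∈ A, c x ≠ p x) :
    vcDim C ≤ d := by
  refine Finset.sup_le fun A hA => ?_
  by_contra! hd
  obtain ⟨B, hBA, hB⟩ := Finset.exists_subset_card_eq (Nat.succ_le_of_lt hd)
  have hsh := (Finset.mem_shatterer.1 hA).mono_right hBA
  obtain ⟨p, hp⟩ := h B hB
  obtain ⟨c, hc, hcB⟩ := shatters_iff.1 hsh p
  obtain ⟨x, hx, hne⟩ := hp c hc
  exact hne (hcB x hx)

/-- A class of VC dimension at most `d` that has at least as many members as Sauer's bound for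
`d` allows is maximum. -/
lemma isMaximum_of_sum_choose_le {d : ℕ} (hd : vcDim C ≤ d) (hcard : d ≤ Fintype.card α)
    (h : ∑ i ∈ Finset.range (d + 1), (Fintype.card α).choose i ≤ C.card) :
    vcDim C = d ∧ IsMaximum C := by
  have hC := card_le_sum_choose C
  have heq : vcDim C = d := by
    refine le_antisymm hd ?_
    by_contra! hlt
    -- Strict because the term `i = d` is positive, as `d ≤ Fintype.card α`.
    have h1 : ∑ i ∈ Finset.range (vcDim C + 1), (Fintype.card α).choose i <
        ∑ i ∈ Finset.range (d + 1), (Fintype.card α).choose i := by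
      refine Finset.sum_lt_sum_of_subset (i := d) (Finset.range_mono (by omega)) (by simp)
        (by simpa using hlt) (Nat.choose_pos hcard) fun _ _ _ => Nat.zero_le _
    omega
  exact ⟨heq, le_antisymm hC (heq ▸ h)⟩

end VC

/-! ### Symmetric functions and the anchor class -/

section Points

variable {n : ℕ}

lemma degree_le (x : Point n) : degree x ≤ n := by
  simpa [degree] using Finset.card_le_univ (support x)

lemma degree_comp_perm (σ : Equiv.Perm (Fin n)) (x : Point n) : degree (x ∘ σ) = degree x := by
  refine Finset.card_bij (fun a _ => σ a) (fun a ha => ?_) (fun a _ b _ h => σ.injective h)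
    fun b hb => ⟨σ.symm b, ?_, by simp⟩
  · rw [mem_support] at ha ⊢
    exact ha
  · rw [mem_support] at hb ⊢
    simpa using hb

lemma exists_perm_of_degree_eq {x y : Point n} (h : degree x = degree y) :
    ∃ σ : Equiv.Perm (Fin n), x ∘ σ = y := by
  have e : {i // y i = true} ≃ {i // x i = true} := Fintype.equivOfCardEq <| by
    rw [Fintype.card_subtype, Fintype.card_subtype]
    exact h.symm
  refine ⟨e.extendSubtype, ?_⟩
  funext i
  rw [Bool.eq_iff_iff, Function.comp_apply]
  by_cases hi : y i = true
  · exact iff_of_true (e.extendSubtype_mem i hi) hi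
  · exact iff_of_false (e.extendSubtype_not_mem i hi) hi

lemma IsSymmetric.apply_eq {f : Concept (Point n)} (hf : IsSymmetric f) {x y : Point n}
    (h : degree x = degree y) : f x = f y := by
  obtain ⟨σ, rfl⟩ := exists_perm_of_degree_eq h
  exact (hf σ x).symm

lemma isSymmetric_comp_degree (g : ℕ → Bool) : IsSymmetric fun x : Point n => g (degree x) :=
  fun σ x => congrArg g (degree_comp_perm σ x)

lemma mem_symmetricClass {f : Concept (Point n)} : f ∈ symmetricClass n ↔ IsSymmetric f := by
  simp [symmetricClass]

/-- The point whose first `i` entries are ones. -/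
def prefixPoint (n i : ℕ) : Point n := fun k => decide ((k : ℕ) < i)

lemma degree_prefixPoint {i : ℕ} (hi : i ≤ n) : degree (prefixPoint n i) = i := by
  have : support (prefixPoint n i) = Finset.univ.filter fun k : Fin n => (k : ℕ) < i := by
    ext k
    simp [mem_support, prefixPoint]
  rw [degree, this, Fin.card_filter_val_lt, min_eq_right hi]

/-- One point of each degree: a function of the degree takes arbitrary values there. -/
lemma le_vcDim_symmetricClass (n : ℕ) : n + 1 ≤ vcDim (symmetricClass n) := by
  have hinj : Set.InjOn (prefixPoint n) (Finset.range (n + 1)) := by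
    intro i hi j hj h
    rw [Finset.mem_coe, Finset.mem_range] at hi hj
    rw [← degree_prefixPoint (n := n) (i := i) (by omega), h, degree_prefixPoint (by omega)]
  have hcard : ((Finset.range (n + 1)).image (prefixPoint n)).card = n + 1 := by
    rw [Finset.card_image_of_injOn hinj, Finset.card_range]
  rw [← hcard]
  refine le_vcDim_of_realises fun p => ⟨fun x => p (prefixPoint n (degree x)),
    mem_symmetricClass.2 (isSymmetric_comp_degree fun i => p (prefixPoint n i)), fun x hx => ?_⟩
  obtain ⟨i, hi, rfl⟩ := Finset.mem_image.1 hx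
  simp only [degree_prefixPoint (Finset.mem_range_succ_iff.1 hi)]

variable {pos : Point n ≃ Fin (2 ^ n)}

lemma existsUnique_isSpecial (pos : Point n ≃ Fin (2 ^ n)) {A : Finset (Point n)}
    (hA : A.card = n + 2) : ∃! m, IsSpecial pos A m := by
  classical
  -- Pigeonhole: `n + 2` points but only `n + 1` degrees.
  obtain ⟨x, hx, y, hy, hxy, hd⟩ := Finset.exists_ne_map_eq_of_card_lt_of_maps_to
    (s := A) (t := Finset.range (n + 1)) (f := degree) (by rw [Finset.card_range]; omega)
    (fun x _ => Finset.mem_coe.2 (Finset.mem_range.2 (Nat.lt_succ_of_le (degree_le x))))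
  obtain ⟨m, hm, hmin⟩ := Finset.exists_min_image (A.filter (IsRepeated A)) pos
    ⟨x, Finset.mem_filter.2 ⟨hx, hx, y, hy, hxy.symm, hd.symm⟩⟩
  have hms : IsSpecial pos A m :=
    ⟨(Finset.mem_filter.1 hm).2, fun z hz => hmin z (Finset.mem_filter.2 ⟨hz.1, hz⟩)⟩
  exact ⟨m, hms, fun z hz => pos.injective (le_antisymm (hz.2 m hms.1) (hms.2 z hz.1))⟩

lemma mem_anchorClass {c : Concept (Point n)} :
    c ∈ anchorClass pos ↔ ∀ A : Finset (Point n), A.card = n + 2 → c ∉ anchoredCube pos A := by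
  simp [anchorClass]

lemma symmetricClass_subset_anchorClass (pos : Point n ≃ Fin (2 ^ n)) :
    symmetricClass n ⊆ anchorClass pos := by
  intro f hf
  rw [mem_symmetricClass] at hf
  rw [mem_anchorClass]
  intro A hA hfA
  obtain ⟨m, hm, huniq⟩ := existsUnique_isSpecial pos hA
  obtain ⟨y, hy, hym, hd⟩ := hm.1.2
  have h1 := (hfA m hm.1.1).2 hm
  rw [← hf.apply_eq hd] at h1
  exact hym (huniq y ((hfA y hy).1 h1))

lemma vcDim_anchorClass_le (pos : Point n ≃ Fin (2 ^ n)) : vcDim (anchorClass pos) ≤ n + 1 := by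
  classical
  refine vcDim_le_of_forall_exists_missing fun A hA =>
    ⟨fun x => decide (IsSpecial pos A x), fun c hc => ?_⟩
  by_contra! h
  refine mem_anchorClass.1 hc A hA fun x hx => ?_
  rw [h x hx, decide_eq_true_iff]

open scoped Classical in
/-- The concept whose zeros are the points of the shifted set of `T`. -/
noncomputable def shiftConcept (pos : Point n ≃ Fin (2 ^ n)) (T : Finset (Point n)) :
    Concept (Point n) :=
  fun x => !decide (IsShifted degree (fun z => (pos z : ℕ)) T x)

lemma shiftConcept_eq_true_iff {T : Finset (Point n)} {x : Point n} :
    shiftConcept pos T x = true ↔ ¬ IsShifted degree (fun z => (pos z : ℕ)) T x := by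
  simp [shiftConcept]

lemma val_pos_injective (pos : Point n ≃ Fin (2 ^ n)) :
    Function.Injective fun z => (pos z : ℕ) :=
  Fin.val_injective.comp pos.injective

lemma shiftConcept_injective (pos : Point n ≃ Fin (2 ^ n)) :
    Function.Injective (shiftConcept pos) := by
  intro T T' h
  have hT : ∀ x, IsShifted degree (fun z => (pos z : ℕ)) T x ↔
      IsShifted degree (fun z => (pos z : ℕ)) T' x := fun x => by
    rw [← not_iff_not, ← shiftConcept_eq_true_iff, ← shiftConcept_eq_true_iff, h]
  exact (subset_of_isShifted_iff (val_pos_injective pos) hT).antisymm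
    (subset_of_isShifted_iff (val_pos_injective pos) fun x => (hT x).symm)

lemma shiftConcept_mem_anchorClass (hpos : IsDegreeOrdering pos) {T : Finset (Point n)}
    (hT : T.card < n + 2) : shiftConcept pos T ∈ anchorClass pos := by
  rw [mem_anchorClass]
  intro A hA hc
  obtain ⟨m, hm, huniq⟩ := existsUnique_isSpecial pos hA
  obtain ⟨y, hy, hym, hd⟩ := hm.1.2
  have := card_le_of_isShifted_iff_ne (T := T) (val_pos_injective pos) (fun x y h => hpos x y h)
    hm.1.1 hy hym hd (fun x hx z hz hzx hd => hm.2 x ⟨hx, z, hz, hzx, hd⟩) fun x hx => by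
      rw [← not_iff_not, ← shiftConcept_eq_true_iff, hc x hx, not_not]
      exact ⟨huniq x, fun h => h ▸ hm⟩
  omega

lemma sum_choose_le_card_anchorClass (hpos : IsDegreeOrdering pos) :
    ∑ i ∈ Finset.range (n + 2), (Fintype.card (Point n)).choose i ≤ (anchorClass pos).card := by
  rw [← card_filter_card_lt]
  exact Finset.card_le_card_of_injOn (shiftConcept pos)
    (fun T hT => shiftConcept_mem_anchorClass hpos (by simpa using hT))
    (shiftConcept_injective pos).injOn

lemma isMaximum_anchorClass (hpos : IsDegreeOrdering pos) :
    vcDim (anchorClass pos) = n + 1 ∧ IsMaximum (anchorClass pos) :=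
  isMaximum_of_sum_choose_le (vcDim_anchorClass_le pos)
    (by simpa using Nat.succ_le_of_lt (Nat.lt_two_pow_self (n := n)))
    (sum_choose_le_card_anchorClass hpos)

lemma exists_isDegreeOrdering (n : ℕ) : ∃ pos : Point n ≃ Fin (2 ^ n), IsDegreeOrdering pos := by
  let e : Point n ≃ Fin (2 ^ n) := Fintype.equivFinOfCardEq (by simp)
  refine ⟨e.trans (Tuple.sort (degree ∘ e.symm)).symm, fun x y h => ?_⟩
  by_contra! hle
  have := Tuple.monotone_sort (degree ∘ e.symm) hle
  simp at this
  omega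

end Points

end BooleanClasses

theorem mainTheorem8 (n : ℕ) :
    BooleanClasses.vcDim (BooleanClasses.symmetricClass n) = n + 1 ∧
    (∃ M : Finset (BooleanClasses.Concept (BooleanClasses.Point n)),
      BooleanClasses.IsMaximum M ∧ BooleanClasses.vcDim M = n + 1 ∧
      BooleanClasses.symmetricClass n ⊆ M) ∧
    ∀ pos : BooleanClasses.Point n ≃ Fin (2 ^ n), BooleanClasses.IsDegreeOrdering pos →
      (∀ A : Finset (BooleanClasses.Point n), A.card = n + 2 →
        ∃! m, BooleanClasses.IsSpecial pos A m) ∧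
      BooleanClasses.IsMaximum (BooleanClasses.anchorClass pos) ∧
      BooleanClasses.vcDim (BooleanClasses.anchorClass pos) = n + 1 ∧
      BooleanClasses.symmetricClass n ⊆ BooleanClasses.anchorClass pos := by
  open BooleanClasses in
  obtain ⟨pos₀, hpos₀⟩ := exists_isDegreeOrdering n
  refine ⟨le_antisymm ?_ (le_vcDim_symmetricClass n), ⟨anchorClass pos₀, ?_⟩,
    fun pos hpos => ⟨fun A hA => existsUnique_isSpecial pos hA, ?_⟩⟩
  · exact (vcDim_mono (symmetricClass_subset_anchorClass pos₀)).trans (vcDim_anchorClass_le pos₀)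
  · exact ⟨(isMaximum_anchorClass hpos₀).2, (isMaximum_anchorClass hpos₀).1,
      symmetricClass_subset_anchorClass pos₀⟩
  · exact ⟨(isMaximum_anchorClass hpos).2, (isMaximum_anchorClass hpos).1,
      symmetricClass_subset_anchorClass pos⟩
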